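/- Let $H:\mathbb R^d\times\mathbb R^d\to\mathbb R$, $(\xi,x)\mapsto H(\xi,x)$, be continuous, with gradients $D_\xi H(\xi,x)$ and $D_xH(\xi,x)$ existing for all $\xi\neq0$ and all $x\in\mathbb R^d$. Assume that there are constants $0<c_0,C_0<\infty$ and $p\ge q\ge1$, and a modulus $\omega:[0,\infty)\to[0,\infty)$ (continuous, $\omega(0)=0$, $\omega(s)>0$ for $s>0$), such that (i) $H(0,x)\le 0$ for all $x\in\mathbb R^d$; (ii) (quantitatively star-shaped sub-level sets) $\frac{\xi}{|\xi|}\cdot D_\xi H(\xi,x)>\omega\big(H(\xi,x)\vee0\big)$ for all $\xi\ne0$ and $x\in\mathbb R^d$; (iii) $c_0|\xi|^q-C_0\le H(\xi,x)\le C_0|\xi|^p+C_0$ for all $\xi,x\in\mathbb R^d$; (iv) $|D_xH(\xi,x)|+(1\vee|\xi|)\,|D_\xi H(\xi,x)|\le C_0(1\vee|\xi|^p)$ for all $\xi\neq 0$ and $x\in\mathbb R^d$. Let $S\subset\mathbb R^d$ be closed, let $\mu>0$, and consider the metric problem $$H(Dm,x)=\mu\ \text{ in }\ \mathbb R^d\setminus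 S,\qquad m=0\ \text{ on }\ \partial S. \qquad (*)$$ Let $m^1$ be a viscosity subsolution of $(*)$, that is, $m^1:\overline{\mathbb R^d\setminus S}\to\mathbb R$ is upper semicontinuous, satisfies $H(Dm^1,x)\le\mu$ in $\mathbb R^d\setminus S$ in the viscosity sense, and $m^1\le0$ on $\partial S$. Let $m^2$ be a non-negative viscosity supersolution of $(*)$, that is, $m^2:\overline{\mathbb R^d\setminus S}\to[0,\infty)$ is lower semicontinuous and satisfies $H(Dm^2,x)\ge\mu$ in $\mathbb R^d\setminus S$ in the viscosity sense. Then $m^1\le m^2$ in $\mathbb R^d\setminus S$. -/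

import Mathlib

open Set Filter Topology

/-- A modulus that is positive away from zero: `ω : [0, ∞) → [0, ∞)` continuous, `ω 0 = 0`, and
`ω s > 0` for `s > 0` (only the values on `[0, ∞)` matter). -/
structure IsPositiveModulus (ω : ℝ → ℝ) : Prop where
  continuousOn : ContinuousOn ω (Ici 0)
  zero : ω 0 = 0
  pos : ∀ s : ℝ, 0 < s → 0 < ω s

/-- The standing assumptions on a Hamiltonian `H ξ x`, with data `c₀, C₀, p, q` and modulus `ω`.
The derivative conditions are imposed at `ξ ≠ 0` only, so that Hamiltonians which are positively
`1`-homogeneous in `ξ` (hence not differentiable at `ξ = 0`) are admitted. -/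
structure IsStarShapedHamiltonian {d : ℕ}
    (H : EuclideanSpace ℝ (Fin d) → EuclideanSpace ℝ (Fin d) → ℝ)
    (c₀ C₀ p q : ℝ) (ω : ℝ → ℝ) : Prop where
  c₀_pos : 0 < c₀
  C₀_pos : 0 < C₀
  one_le_q : 1 ≤ q
  q_le_p : q ≤ p
  modulus : IsPositiveModulus ω
  /-- `H` is jointly continuous. -/
  continuous : Continuous fun z : EuclideanSpace ℝ (Fin d) × EuclideanSpace ℝ (Fin d) => H z.1 z.2
  /-- `D_ξ H` exists. -/
  differentiableAt_momentum : ∀ ξ x, ξ ≠ 0 → DifferentiableAt ℝ (fun ζ => H ζ x) ξ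
  /-- `D_x H` exists. -/
  differentiableAt_space : ∀ ξ x, ξ ≠ 0 → DifferentiableAt ℝ (fun y => H ξ y) x
  /-- Normalization: `H(0, x) ≤ 0`. -/
  normalized : ∀ x, H 0 x ≤ 0
  /-- Quantitative star-shapedness: `(ξ / |ξ|) · D_ξ H(ξ, x) > ω (H(ξ, x) ∨ 0)`. -/
  starShaped : ∀ ξ x, ξ ≠ 0 →
    ω (max (H ξ x) 0) < inner ℝ (‖ξ‖⁻¹ • ξ) (gradient (fun ζ => H ζ x) ξ)
  /-- Coercivity: `c₀ |ξ|^q - C₀ ≤ H(ξ, x)`. -/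
  coercive : ∀ ξ x, c₀ * ‖ξ‖ ^ q - C₀ ≤ H ξ x
  /-- Growth: `H(ξ, x) ≤ C₀ |ξ|^p + C₀`. -/
  growth : ∀ ξ x, H ξ x ≤ C₀ * ‖ξ‖ ^ p + C₀
  /-- `|D_x H(ξ, x)| + (1 ∨ |ξ|) |D_ξ H(ξ, x)| ≤ C₀ (1 ∨ |ξ|^p)`. -/
  gradient_bound : ∀ ξ x, ξ ≠ 0 →
    ‖gradient (fun y => H ξ y) x‖ + max 1 ‖ξ‖ * ‖gradient (fun ζ => H ζ x) ξ‖
      ≤ C₀ * max 1 (‖ξ‖ ^ p)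

/-- `H(Dm, x) ≤ μ` in the open set `U` in the viscosity sense: whenever `φ` is `C¹` near `x ∈ U`
and `m - φ` has a local maximum at `x`, then `H(Dφ(x), x) ≤ μ`. -/
def ViscositySubOn {d : ℕ} (H : EuclideanSpace ℝ (Fin d) → EuclideanSpace ℝ (Fin d) → ℝ)
    (μ : ℝ) (U : Set (EuclideanSpace ℝ (Fin d))) (m : EuclideanSpace ℝ (Fin d) → ℝ) : Prop :=
  ∀ (φ : EuclideanSpace ℝ (Fin d) → ℝ), ∀ x ∈ U, ContDiffAt ℝ 1 φ x →
    IsLocalMax (fun y => m y - φ y) x → H (gradient φ x) x ≤ μ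

/-- `H(Dm, x) ≥ μ` in the open set `U` in the viscosity sense: whenever `φ` is `C¹` near `x ∈ U`
and `m - φ` has a local minimum at `x`, then `H(Dφ(x), x) ≥ μ`. -/
def ViscositySuperOn {d : ℕ} (H : EuclideanSpace ℝ (Fin d) → EuclideanSpace ℝ (Fin d) → ℝ)
    (μ : ℝ) (U : Set (EuclideanSpace ℝ (Fin d))) (m : EuclideanSpace ℝ (Fin d) → ℝ) : Prop :=
  ∀ (φ : EuclideanSpace ℝ (Fin d) → ℝ), ∀ x ∈ U, ContDiffAt ℝ 1 φ x →
    IsLocalMin (fun y => m y - φ y) x → μ ≤ H (gradient φ x) x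

/-- Subsolution of the metric problem `H(Dm, x) = μ` in `ℝᵈ \ S`, `m = 0` on `∂S`: upper
semicontinuous up to the boundary, a viscosity subsolution in `ℝᵈ \ S`, and `m ≤ 0` on `∂S`. -/
structure IsMetricSubsolution {d : ℕ}
    (H : EuclideanSpace ℝ (Fin d) → EuclideanSpace ℝ (Fin d) → ℝ)
    (μ : ℝ) (S : Set (EuclideanSpace ℝ (Fin d))) (m : EuclideanSpace ℝ (Fin d) → ℝ) : Prop where
  usc : UpperSemicontinuousOn m (closure Sᶜ)
  viscosity : ViscositySubOn H μ Sᶜ m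
  boundary : ∀ x ∈ frontier S, m x ≤ 0

/-- Supersolution of the metric problem `H(Dm, x) = μ` in `ℝᵈ \ S`, `m = 0` on `∂S`: lower
semicontinuous up to the boundary, a viscosity supersolution in `ℝᵈ \ S`, and `m ≥ 0` on `∂S`. -/
structure IsMetricSupersolution {d : ℕ}
    (H : EuclideanSpace ℝ (Fin d) → EuclideanSpace ℝ (Fin d) → ℝ)
    (μ : ℝ) (S : Set (EuclideanSpace ℝ (Fin d))) (m : EuclideanSpace ℝ (Fin d) → ℝ) : Prop where
  lsc : LowerSemicontinuousOn m (closure Sᶜ)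
  viscosity : ViscositySuperOn H μ Sᶜ m
  boundary : ∀ x ∈ frontier S, 0 ≤ m x

/-- The Euclidean space `ℝᵈ`. -/
local notation "𝔼" d => EuclideanSpace ℝ (Fin d)

namespace IsStarShapedHamiltonian

variable {d : ℕ} {H : (𝔼 d) → (𝔼 d) → ℝ} {c₀ C₀ p q μ : ℝ} {ω : ℝ → ℝ}

theorem hasDerivAt_line (hH : IsStarShapedHamiltonian H c₀ C₀ p q ω) (a b x : 𝔼 d) (t : ℝ)
    (h : a + t • b ≠ 0) :
    HasDerivAt (fun s : ℝ => H (a + s • b) x)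
      (inner ℝ (gradient (fun ζ => H ζ x) (a + t • b)) b) t := by
  have h1 : HasFDerivAt (fun ζ => H ζ x) _ (a + t • b) :=
    (hH.differentiableAt_momentum _ x h).hasGradientAt.hasFDerivAt
  have h2 : HasDerivAt (fun s : ℝ => a + s • b) b t := by
    simpa using ((hasDerivAt_id t).smul_const b).const_add a
  have h3 := h1.comp_hasDerivAt t h2
  rwa [InnerProductSpace.toDual_apply_apply] at h3

theorem continuous_line (hH : IsStarShapedHamiltonian H c₀ C₀ p q ω) (a b x : 𝔼 d) :
    Continuous fun s : ℝ => H (a + s • b) x :=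
  hH.continuous.comp (f := fun s : ℝ => (a + s • b, x)) (by fun_prop)

theorem one_le_p (hH : IsStarShapedHamiltonian H c₀ C₀ p q ω) : 1 ≤ p :=
  hH.one_le_q.trans hH.q_le_p

theorem gradient_bound_of_norm_le (hH : IsStarShapedHamiltonian H c₀ C₀ p q ω) {R : ℝ}
    (hR : 1 ≤ R) {ξ : 𝔼 d} (h0 : ξ ≠ 0) (hξ : ‖ξ‖ ≤ R) (x : 𝔼 d) :
    ‖gradient (fun y => H ξ y) x‖ ≤ C₀ * R ^ p ∧
      ‖gradient (fun ζ => H ζ x) ξ‖ ≤ C₀ * R ^ p := by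
  have hp : 0 ≤ p := zero_le_one.trans hH.one_le_p
  have h1 := hH.gradient_bound ξ x h0
  have h2 : max 1 (‖ξ‖ ^ p) ≤ R ^ p :=
    max_le (Real.one_le_rpow hR hp) (Real.rpow_le_rpow (norm_nonneg _) hξ hp)
  have h3 := mul_le_mul_of_nonneg_left h2 hH.C₀_pos.le
  have h4 : ‖gradient (fun ζ => H ζ x) ξ‖ ≤ max 1 ‖ξ‖ * ‖gradient (fun ζ => H ζ x) ξ‖ :=
    le_mul_of_one_le_left (norm_nonneg _) (le_max_left _ _)
  have h5 := norm_nonneg (gradient (fun y => H ξ y) x)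
  have h6 := norm_nonneg (gradient (fun ζ => H ζ x) ξ)
  constructor <;> linarith

/-- `H` is Lipschitz in the momentum along segments whose interior avoids the origin. -/
theorem sub_le_of_segment (hH : IsStarShapedHamiltonian H c₀ C₀ p q ω) {R : ℝ} (hR : 1 ≤ R)
    {a b : 𝔼 d} (ha : ‖a‖ ≤ R) (hab : ‖a + b‖ ≤ R) (h0 : ∀ t ∈ Ioo (0 : ℝ) 1, a + t • b ≠ 0)
    (x : 𝔼 d) : |H (a + b) x - H a x| ≤ C₀ * R ^ p * ‖b‖ := by
  obtain ⟨t, ht, h⟩ := exists_hasDerivAt_eq_slope (fun s : ℝ => H (a + s • b) x)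
    (fun s => inner ℝ (gradient (fun ζ => H ζ x) (a + s • b)) b) zero_lt_one
    (hH.continuous_line a b x).continuousOn (fun s hs => hH.hasDerivAt_line a b x s (h0 s hs))
  simp only [one_smul, zero_smul, add_zero, sub_zero, div_one] at h
  rw [← h]
  have hmem : ‖a + t • b‖ ≤ R := by
    have h1 : a + t • b = (1 - t) • a + t • (a + b) := by module
    rw [h1]
    refine (norm_add_le _ _).trans ?_
    rw [norm_smul, norm_smul, Real.norm_of_nonneg ht.1.le,
      Real.norm_of_nonneg (sub_nonneg.2 ht.2.le)]
    nlinarith [ht.1, ht.2]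
  refine (abs_real_inner_le_norm _ _).trans ?_
  gcongr
  exact (hH.gradient_bound_of_norm_le hR (h0 t ht) hmem x).2

theorem sub_le_of_space (hH : IsStarShapedHamiltonian H c₀ C₀ p q ω) {R : ℝ} (hR : 1 ≤ R)
    {ξ : 𝔼 d} (h0 : ξ ≠ 0) (hξ : ‖ξ‖ ≤ R) (x y : 𝔼 d) :
    |H ξ y - H ξ x| ≤ C₀ * R ^ p * ‖y - x‖ := by
  have h := convex_univ.norm_image_sub_le_of_norm_fderiv_le (𝕜 := ℝ) (f := fun z => H ξ z)
    (C := C₀ * R ^ p) (fun z _ => hH.differentiableAt_space ξ z h0) (fun z _ => ?_)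
    (mem_univ x) (mem_univ y)
  · simpa using h
  · have h1 := (hH.gradient_bound_of_norm_le hR h0 hξ z).1
    rwa [gradient, LinearIsometryEquiv.norm_map] at h1

theorem le_mul_norm (hH : IsStarShapedHamiltonian H c₀ C₀ p q ω) {ξ : 𝔼 d} (hξ : ‖ξ‖ ≤ 1)
    (x : 𝔼 d) : H ξ x ≤ C₀ * ‖ξ‖ := by
  rcases eq_or_ne ξ 0 with rfl | h0
  · simpa using hH.normalized x
  have h := hH.sub_le_of_segment le_rfl (a := 0) (b := ξ) (by simp) (by simpa using hξ)
    (fun t ht => by simpa using ⟨ht.1.ne', h0⟩) x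
  have h2 := hH.normalized x
  simp only [zero_add, Real.one_rpow, mul_one] at h
  linarith [le_abs_self (H ξ x - H 0 x)]

/-- Momenta at which `H` has a positive value stay away from the origin. -/
theorem exists_le_half (hH : IsStarShapedHamiltonian H c₀ C₀ p q ω) (hμ : 0 < μ) :
    ∃ r > 0, ∀ ξ x : 𝔼 d, ‖ξ‖ ≤ r → H ξ x ≤ μ / 2 := by
  have hC := hH.C₀_pos
  refine ⟨min 1 (μ / (2 * C₀)), by positivity, fun ξ x hξ => ?_⟩
  refine (hH.le_mul_norm (hξ.trans (min_le_left _ _)) x).trans ?_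
  have h1 := mul_le_mul_of_nonneg_left (hξ.trans (min_le_right _ _)) hC.le
  refine h1.trans (le_of_eq ?_)
  field_simp

/-- Sublevel sets of `H` are bounded. -/
theorem exists_norm_le (hH : IsStarShapedHamiltonian H c₀ C₀ p q ω) (μ : ℝ) :
    ∃ R, 1 ≤ R ∧ ∀ ξ x : 𝔼 d, H ξ x ≤ μ → ‖ξ‖ ≤ R := by
  refine ⟨max 1 ((μ + C₀) / c₀), le_max_left _ _, fun ξ x h => ?_⟩
  rcases le_total ‖ξ‖ 1 with h1 | h1
  · exact h1.trans (le_max_left _ _)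
  · refine le_trans ?_ (le_max_right _ _)
    rw [le_div_iff₀ hH.c₀_pos]
    have h2 := Real.rpow_le_rpow_of_exponent_le h1 hH.one_le_q
    rw [Real.rpow_one] at h2
    have h3 := hH.coercive ξ x
    nlinarith [hH.c₀_pos]

/-- Contracting a momentum in the sublevel set `{H ≤ μ}` by a factor at most `l < 1` decreases the
value of `H` below `μ` by a definite amount. -/
theorem exists_margin (hH : IsStarShapedHamiltonian H c₀ C₀ p q ω) (hμ : 0 < μ) {l : ℝ}
    (hl : l < 1) :
    ∃ δ > 0, ∀ ξ x : 𝔼 d, H ξ x ≤ μ → ∀ θ, 0 ≤ θ → θ ≤ l → H (θ • ξ) x ≤ μ - δ := by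
  obtain ⟨r, hr, hr'⟩ := hH.exists_le_half hμ
  obtain ⟨s₀, hs₀, hmin⟩ := (isCompact_Icc (a := μ / 2) (b := μ)).exists_isMinOn
    (nonempty_Icc.2 (by linarith))
    (hH.modulus.continuousOn.mono fun s hs => le_trans (by positivity) hs.1)
  have hω : 0 < ω s₀ := hH.modulus.pos _ (lt_of_lt_of_le (by positivity) hs₀.1)
  have hω0 : ∀ s, 0 ≤ s → 0 ≤ ω s := fun s hs => by
    rcases hs.eq_or_lt with rfl | hs
    · exact hH.modulus.zero.ge
    · exact (hH.modulus.pos s hs).le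
  have h1l : 0 < 1 - l := by linarith
  refine ⟨min (μ / 2) ((1 - l) * (r * ω s₀)), by positivity, fun ξ x hξ θ hθ0 hθl => ?_⟩
  rcases le_or_gt (H (θ • ξ) x) (μ / 2) with h | h
  · linarith [min_le_left (μ / 2) ((1 - l) * (r * ω s₀))]
  have hξ0 : ξ ≠ 0 := by
    rintro rfl
    have := hH.normalized x
    rw [smul_zero] at h
    linarith
  have hθpos : 0 < θ := by
    refine hθ0.lt_of_ne ?_
    rintro rfl
    have := hH.normalized x
    rw [zero_smul] at h
    linarith
  have hrξ : r ≤ ‖ξ‖ := by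
    by_contra! hlt
    have : ‖θ • ξ‖ ≤ r := by
      rw [norm_smul, Real.norm_of_nonneg hθ0]
      nlinarith [norm_nonneg ξ]
    linarith [hr' _ x this]
  have hder : ∀ s : ℝ, 0 < s → HasDerivAt (fun s : ℝ => H (s • ξ) x)
      (inner ℝ (gradient (fun ζ => H ζ x) (s • ξ)) ξ) s := fun s hs => by
    simpa using hH.hasDerivAt_line 0 ξ x s (by simpa using ⟨hs.ne', hξ0⟩)
  have hbig : ∀ s : ℝ, 0 < s → ‖ξ‖ * ω (max (H (s • ξ) x) 0) <
      inner ℝ (gradient (fun ζ => H ζ x) (s • ξ)) ξ := fun s hs => by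
    have h1 := hH.starShaped (s • ξ) x (by simpa using ⟨hs.ne', hξ0⟩)
    have hn : 0 < ‖ξ‖ := norm_pos_iff.2 hξ0
    have h2 : ‖s • ξ‖⁻¹ • s • ξ = ‖ξ‖⁻¹ • ξ := by
      rw [norm_smul, Real.norm_of_nonneg hs.le, smul_smul]
      congr 1
      field_simp
    rw [h2, real_inner_smul_left, real_inner_comm, inv_mul_eq_div, lt_div_iff₀ hn] at h1
    rwa [mul_comm]
  have hmono : StrictMonoOn (fun s : ℝ => H (s • ξ) x) (Ioi 0) := by
    refine strictMonoOn_of_deriv_pos (convex_Ioi 0)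
      (fun s hs => (hder s hs).continuousAt.continuousWithinAt) fun s hs => ?_
    rw [interior_Ioi] at hs
    rw [(hder s hs).deriv]
    exact (mul_nonneg (norm_nonneg _) (hω0 _ (le_max_right _ _))).trans_lt (hbig s hs)
  have hθ1 : θ < 1 := hθl.trans_lt hl
  obtain ⟨t, ht, hslope⟩ := exists_hasDerivAt_eq_slope (fun s : ℝ => H (s • ξ) x)
    (fun s => inner ℝ (gradient (fun ζ => H ζ x) (s • ξ)) ξ) hθ1
    (fun s hs => (hder s (hθpos.trans_le hs.1)).continuousAt.continuousWithinAt)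
    (fun s hs => hder s (hθpos.trans hs.1))
  have ht0 : 0 < t := hθpos.trans ht.1
  have hlow : H (θ • ξ) x < H (t • ξ) x := hmono hθpos ht0 ht.1
  have hup : H (t • ξ) x < H ((1 : ℝ) • ξ) x := hmono ht0 (mem_Ioi.2 one_pos) ht.2
  rw [one_smul] at hup
  have hωt : ω s₀ ≤ ω (max (H (t • ξ) x) 0) := by
    rw [max_eq_left (by linarith)]
    exact hmin ⟨by linarith, by linarith⟩
  have h3 : r * ω s₀ ≤ ‖ξ‖ * ω (max (H (t • ξ) x) 0) := by gcongr
  have h4 := h3.trans (hbig t ht0).le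
  rw [eq_div_iff (by linarith)] at hslope
  simp only [one_smul] at hslope
  have h5 : (1 - l) * (r * ω s₀) ≤ H ξ x - H (θ • ξ) x := by
    rw [← hslope, mul_comm]
    have : 0 < r * ω s₀ := by positivity
    gcongr
    linarith
  linarith [min_le_right (μ / 2) ((1 - l) * (r * ω s₀))]

end IsStarShapedHamiltonian

/-- The bounded increasing change of variables `t ↦ l t / (1 + k t)` on `[0, ∞)`. -/
noncomputable def saturate (l k t : ℝ) : ℝ := l * t / (1 + k * t)

section saturate

variable {l k t s : ℝ}

theorem saturate_nonneg (hl : 0 < l) (hk : 0 < k) (ht : 0 ≤ t) : 0 ≤ saturate l k t := by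
  unfold saturate; positivity

theorem saturate_lt (hl : 0 < l) (hk : 0 < k) (ht : 0 ≤ t) : saturate l k t < l / k := by
  unfold saturate
  rw [div_lt_div_iff₀ (by positivity) hk]
  nlinarith

theorem saturate_mono (hl : 0 < l) (hk : 0 < k) (hs : 0 ≤ s) (hst : s ≤ t) :
    saturate l k s ≤ saturate l k t := by
  have ht := hs.trans hst
  unfold saturate
  rw [div_le_div_iff₀ (by positivity) (by positivity)]
  nlinarith

theorem le_of_saturate_le (hk : 0 < k) (ht : 0 ≤ t) (h : saturate l k t ≤ s) (hs : s < l / k) :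
    t ≤ s / (l - k * s) := by
  unfold saturate at h
  rw [div_le_iff₀ (by positivity)] at h
  rw [lt_div_iff₀ hk] at hs
  rw [le_div_iff₀ (by linarith)]
  linarith

theorem eq_of_saturate_eq (hl : 0 < l) (hk : 0 < k) (ht : 0 ≤ t) :
    saturate l k t / (l - k * saturate l k t) = t := by
  unfold saturate
  have : 1 + k * t ≠ 0 := by positivity
  field_simp
  ring

theorem exists_lt_saturate {a b : ℝ} (hab : a < b) :
    ∃ k > 0, a < saturate (1 + k)⁻¹ k b := by
  have h : ContinuousAt (fun k : ℝ => saturate (1 + k)⁻¹ k b) 0 := by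
    unfold saturate
    refine ContinuousAt.div ?_ (by fun_prop) (by simp)
    exact ((continuousAt_const.add continuousAt_id).inv₀ (by simp)).mul continuousAt_const
  have h1 : ∀ᶠ k in 𝓝[>] (0 : ℝ), a < saturate (1 + k)⁻¹ k b := by
    refine (h.mono_left nhdsWithin_le_nhds).eventually_const_lt ?_
    simpa [saturate] using hab
  obtain ⟨k, hk, hk0⟩ := (h1.and self_mem_nhdsWithin).exists
  exact ⟨k, hk0, hk⟩

end saturate

theorem hasGradientAt_const_mul_norm_sub_sq {d : ℕ} (A : ℝ) (x y : 𝔼 d) :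
    HasGradientAt (fun z => A * ‖z - y‖ ^ 2) ((2 * A) • (x - y)) x := by
  rw [hasGradientAt_iff_hasFDerivAt]
  have h := (((hasFDerivAt_id x).sub_const y).norm_sq).const_mul A
  refine h.congr_fderiv ?_
  ext v
  simp
  ring

/-- Where a viscosity subsolution is positive, the saturation of its positive part is a strict
viscosity subsolution (tested from above by `ψ` globally). -/
theorem ViscositySubOn.exists_smul_of_saturate {d : ℕ} {H : (𝔼 d) → (𝔼 d) → ℝ} {μ : ℝ}
    {U : Set (𝔼 d)} {m : (𝔼 d) → ℝ} (hm : ViscositySubOn H μ U m) {l k : ℝ} (hl : 0 < l)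
    (hk : 0 < k) {w : (𝔼 d) → ℝ} {x g : 𝔼 d} (hx : x ∈ U) (hw0 : ∀ y, 0 ≤ w y)
    (hmw : ∀ᶠ y in 𝓝 x, m y ≤ w y) (hmwx : m x = w x) {ψ : (𝔼 d) → ℝ} (hψ : ContDiffAt ℝ 1 ψ x)
    (hg : HasGradientAt ψ g x) (hψw : ∀ y, saturate l k (w y) ≤ ψ y)
    (hψx : saturate l k (w x) = ψ x) :
    ∃ θ ξ, 0 ≤ θ ∧ θ ≤ l ∧ g = θ • ξ ∧ H ξ x ≤ μ := by
  have hlt : ψ x < l / k := hψx ▸ saturate_lt hl hk (hw0 x)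
  have hden : 0 < l - k * ψ x := by
    rw [lt_div_iff₀ hk] at hlt
    linarith
  set a : ℝ := l / (l - k * ψ x) ^ 2 with ha
  have hapos : 0 < a := by positivity
  have hG : HasDerivAt (fun s : ℝ => s / (l - k * s)) a (ψ x) := by
    have h1 : HasDerivAt (fun s : ℝ => l - k * s) (-k) (ψ x) := by
      simpa using ((hasDerivAt_id (ψ x)).const_mul k).const_sub l
    refine ((hasDerivAt_id (ψ x)).div h1 hden.ne').congr_deriv ?_
    rw [ha]
    congr 1
    simp only [id]
    ring
  have hgrad : HasGradientAt (fun y => ψ y / (l - k * ψ y)) (a • g) x := by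
    rw [hasGradientAt_iff_hasFDerivAt] at hg ⊢
    refine (hG.comp_hasFDerivAt x hg).congr_fderiv ?_
    simp
  have hcd : ContDiffAt ℝ 1 (fun y => ψ y / (l - k * ψ y)) x :=
    hψ.div (contDiffAt_const.sub (contDiffAt_const.mul hψ)) hden.ne'
  have hmax : IsLocalMax (fun y => m y - ψ y / (l - k * ψ y)) x := by
    have h1 : ∀ᶠ y in 𝓝 x, ψ y < l / k := hψ.continuousAt.eventually_lt_const hlt
    filter_upwards [h1, hmw] with y hy1 hy2
    have h2 := le_of_saturate_le hk (hw0 y) (hψw y) hy1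
    have h3 := eq_of_saturate_eq hl hk (hw0 x)
    rw [hψx] at h3
    rw [h3, hmwx]
    linarith
  have hsub := hm _ x hx hcd hmax
  rw [hgrad.gradient] at hsub
  refine ⟨a⁻¹, a • g, by positivity, ?_, by rw [smul_smul, inv_mul_cancel₀ hapos.ne', one_smul],
    hsub⟩
  rw [ha, inv_div, div_le_iff₀ hl]
  have h0 : 0 ≤ k * ψ x := by
    rw [← hψx]
    exact mul_nonneg hk.le (saturate_nonneg hl hk (hw0 x))
  nlinarith

/-- The penalized doubling of variables attains its maximum. -/
theorem exists_isMax_doubling {d : ℕ} {u v : (𝔼 d) → ℝ} (hu : UpperSemicontinuous u)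
    (hv : LowerSemicontinuous v) {B : ℝ} (huB : ∀ x, u x ≤ B) (hv0 : ∀ x, 0 ≤ v x) (x₀ : 𝔼 d)
    (h₀ : 0 ≤ u x₀ - v x₀) {A η : ℝ} (hA : 0 < A) (hη : 0 < η) :
    ∃ x y : 𝔼 d, (∀ x' y', u x' - v y' - A * ‖x' - y'‖ ^ 2 - η * ‖x' - x₀‖ ^ 2 ≤
      u x - v y - A * ‖x - y‖ ^ 2 - η * ‖x - x₀‖ ^ 2) := by
  set Φ : (𝔼 d) × (𝔼 d) → ℝ := fun z =>
    u z.1 + (-v z.2 + (-(A * ‖z.1 - z.2‖ ^ 2) + -(η * ‖z.1 - x₀‖ ^ 2))) with hΦ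
  have husc : UpperSemicontinuous Φ := by
    refine (hu.comp continuous_fst).add (UpperSemicontinuous.add ?_ ?_)
    · exact (hv.comp continuous_snd).neg
    · exact Continuous.upperSemicontinuous (by fun_prop)
  set r₁ : ℝ := Real.sqrt (B / η)
  set r₂ : ℝ := Real.sqrt (B / A)
  have hK : IsCompact (Metric.closedBall x₀ r₁ ×ˢ Metric.closedBall x₀ (r₁ + r₂)) :=
    (isCompact_closedBall _ _).prod (isCompact_closedBall _ _)
  have hout : ∀ z, 0 ≤ Φ z → z ∈ Metric.closedBall x₀ r₁ ×ˢ Metric.closedBall x₀ (r₁ + r₂) := by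
    rintro ⟨x, y⟩ hz
    simp only [hΦ] at hz
    have hAB : 0 ≤ A * ‖x - y‖ ^ 2 := by positivity
    have hηB : 0 ≤ η * ‖x - x₀‖ ^ 2 := by positivity
    have h1 : ‖x - x₀‖ ≤ r₁ := by
      refine Real.le_sqrt_of_sq_le ((le_div_iff₀ hη).2 ?_)
      linarith [huB x, hv0 y]
    have h2 : ‖x - y‖ ≤ r₂ := by
      refine Real.le_sqrt_of_sq_le ((le_div_iff₀ hA).2 ?_)
      linarith [huB x, hv0 y]
    refine ⟨by simpa [dist_eq_norm] using h1, ?_⟩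
    rw [Metric.mem_closedBall, dist_eq_norm]
    have h3 : y - x₀ = (x - x₀) - (x - y) := by abel
    simp only
    rw [h3]
    exact (norm_sub_le _ _).trans (add_le_add h1 h2)
  have hΦ₀ : 0 ≤ Φ (x₀, x₀) := by simpa [hΦ] using h₀
  obtain ⟨z, -, hz⟩ := (husc.upperSemicontinuousOn _).exists_isMaxOn ⟨_, hout _ hΦ₀⟩ hK
  have hz' : ∀ z', Φ z' ≤ Φ z := fun z' => by
    by_cases h : 0 ≤ Φ z'
    · exact hz (hout z' h)
    · exact (not_le.1 h).le.trans (hΦ₀.trans (hz (hout _ hΦ₀)))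
  refine ⟨z.1, z.2, fun x' y' => ?_⟩
  have := hz' (x', y')
  simp only [hΦ] at this
  linarith

theorem UpperSemicontinuous.saturate {d : ℕ} {w : (𝔼 d) → ℝ} (hw : UpperSemicontinuous w)
    (hw0 : ∀ x, 0 ≤ w x) {l k : ℝ} (hl : 0 < l) (hk : 0 < k) :
    UpperSemicontinuous fun x => saturate l k (w x) := by
  intro x c hc
  have hcont : ContinuousAt (fun t => _root_.saturate l k t) (w x) := by
    unfold _root_.saturate
    refine ContinuousAt.div (by fun_prop) (by fun_prop) ?_
    have := hw0 x
    positivity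
  obtain ⟨e, he, hec⟩ : ∃ e, w x < e ∧ _root_.saturate l k e < c := by
    have h1 : ∀ᶠ t in 𝓝[>] (w x), _root_.saturate l k t < c :=
      (hcont.mono_left nhdsWithin_le_nhds).eventually_lt_const hc
    obtain ⟨e, he, he'⟩ := (h1.and self_mem_nhdsWithin).exists
    exact ⟨e, he', he⟩
  filter_upwards [hw x e he] with y hy
  exact (saturate_mono hl hk (hw0 y) hy.le).trans_lt hec

open Classical in
/-- The positive part of a subsolution, extended by zero to `S`, is upper semicontinuous. -/
theorem upperSemicontinuous_positivePart {d : ℕ} {S : Set (𝔼 d)} (hS : IsClosed S)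
    {m : (𝔼 d) → ℝ} (hm : UpperSemicontinuousOn m (closure Sᶜ))
    (hb : ∀ x ∈ frontier S, m x ≤ 0) :
    UpperSemicontinuous fun x => if x ∈ S then 0 else max (m x) 0 := by
  intro x c hc
  by_cases hx : x ∈ S
  · simp only [if_pos hx] at hc
    by_cases hx' : x ∈ closure Sᶜ
    · have hfr : x ∈ frontier S := by
        rw [frontier_eq_closure_inter_closure]
        exact ⟨subset_closure hx, hx'⟩
      have h1 := hm x hx' c ((hb x hfr).trans_lt hc)
      rw [eventually_nhdsWithin_iff] at h1
      filter_upwards [h1] with y hy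
      split_ifs with h
      · exact hc
      · exact max_lt (hy (subset_closure h)) hc
    · filter_upwards [isClosed_closure.isOpen_compl.mem_nhds hx'] with y hy
      rw [if_pos]
      · exact hc
      · by_contra h
        exact hy (subset_closure h)
  · simp only [if_neg hx] at hc
    have h1 := hm x (subset_closure hx) c ((le_max_left _ _).trans_lt hc)
    rw [eventually_nhdsWithin_iff] at h1
    filter_upwards [h1, hS.isOpen_compl.mem_nhds hx] with y hy hyS
    rw [if_neg hyS]
    exact max_lt (hy (subset_closure hyS)) ((le_max_right _ _).trans_lt hc)

open Classical in
/-- A non-negative supersolution, extended by zero to `S`, is lower semicontinuous. -/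
theorem lowerSemicontinuous_extendByZero {d : ℕ} {S : Set (𝔼 d)} (hS : IsClosed S)
    {m : (𝔼 d) → ℝ} (hm : LowerSemicontinuousOn m (closure Sᶜ)) (h0 : ∀ x ∈ Sᶜ, 0 ≤ m x) :
    LowerSemicontinuous fun x => if x ∈ S then 0 else m x := by
  intro x c hc
  by_cases hx : x ∈ S
  · simp only [if_pos hx] at hc
    refine Eventually.of_forall fun y => ?_
    change c < if y ∈ S then 0 else m y
    split_ifs with h
    · exact hc
    · exact hc.trans_le (h0 y h)
  · simp only [if_neg hx] at hc
    have h1 := hm x (subset_closure hx) c hc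
    rw [eventually_nhdsWithin_iff] at h1
    filter_upwards [h1, hS.isOpen_compl.mem_nhds hx] with y hy hyS
    rw [if_neg hyS]
    exact hy (subset_closure hyS)

theorem mainTheorem8 {d : ℕ}
    (H : EuclideanSpace ℝ (Fin d) → EuclideanSpace ℝ (Fin d) → ℝ)
    (c₀ C₀ p q : ℝ) (ω : ℝ → ℝ) (hH : IsStarShapedHamiltonian H c₀ C₀ p q ω)
    (S : Set (EuclideanSpace ℝ (Fin d))) (hS : IsClosed S)
    (μ : ℝ) (hμ : 0 < μ)
    (m₁ m₂ : EuclideanSpace ℝ (Fin d) → ℝ)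
    (h₁ : IsMetricSubsolution H μ S m₁)
    (h₂ : IsMetricSupersolution H μ S m₂)
    (h₂_nonneg : ∀ x ∈ Sᶜ, 0 ≤ m₂ x) :
    ∀ x ∈ Sᶜ, m₁ x ≤ m₂ x := by
  classical
  intro x₀ hx₀
  by_contra! hlt
  set w : (𝔼 d) → ℝ := fun x => if x ∈ S then 0 else max (m₁ x) 0 with hw
  set v : (𝔼 d) → ℝ := fun x => if x ∈ S then 0 else m₂ x with hv
  have hwusc : UpperSemicontinuous w := upperSemicontinuous_positivePart hS h₁.usc h₁.boundary
  have hvlsc : LowerSemicontinuous v := lowerSemicontinuous_extendByZero hS h₂.lsc h₂_nonneg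
  have hw0 : ∀ x, 0 ≤ w x := fun x => by
    simp only [hw]
    split_ifs
    exacts [le_rfl, le_max_right _ _]
  have hv0 : ∀ x, 0 ≤ v x := fun x => by
    simp only [hv]
    split_ifs with h
    exacts [le_rfl, h₂_nonneg x h]
  have hwpos : ∀ x, 0 < w x → x ∈ Sᶜ ∧ m₁ x = w x := fun x hx => by
    have hxS : x ∉ S := fun h => by simp [hw, h] at hx
    refine ⟨hxS, ?_⟩
    simp only [hw, if_neg hxS] at hx ⊢
    rcases le_total (m₁ x) 0 with h | h
    · rw [max_eq_right h] at hx
      exact absurd hx (lt_irrefl _)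
    · rw [max_eq_left h]
  have hvw₀ : v x₀ < w x₀ := by
    simp only [hw, hv, if_neg hx₀]
    exact hlt.trans_le (le_max_left _ _)
  obtain ⟨k, hk, hk₀⟩ := exists_lt_saturate hvw₀
  set l : ℝ := (1 + k)⁻¹ with hl_def
  have hl : 0 < l := by positivity
  have hl1 : l < 1 := inv_lt_one_of_one_lt₀ (by linarith)
  set u : (𝔼 d) → ℝ := fun x => saturate l k (w x) with hu
  have huusc : UpperSemicontinuous u := hwusc.saturate hw0 hl hk
  set B : ℝ := l / k
  have hBpos : 0 < B := by positivity
  have huB : ∀ x, u x ≤ B := fun x => (saturate_lt hl hk (hw0 x)).le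
  set σ : ℝ := u x₀ - v x₀ with hσ
  have hσpos : 0 < σ := sub_pos.2 hk₀
  obtain ⟨δ, hδ, hmargin⟩ := hH.exists_margin hμ hl1
  obtain ⟨R, hR1, hR⟩ := hH.exists_norm_le μ
  obtain ⟨r, hr, hr'⟩ := hH.exists_le_half hμ
  -- The Lipschitz constant of `H` for the momenta that occur.
  set L : ℝ := C₀ * (R + 1) ^ p with hL
  have hLpos : 0 < L := mul_pos hH.C₀_pos (Real.rpow_pos_of_pos (by linarith) _)
  set e : ℝ := min (min 1 r) (δ / (4 * L)) with he
  have hepos : 0 < e := by positivity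
  -- The penalization is so weak that its gradient has norm less than `e`.
  set η : ℝ := e ^ 2 / (8 * B) with hη
  have hηpos : 0 < η := by positivity
  -- The superlevel set of `u` that contains the maxima stays away from `S`.
  set K : Set (𝔼 d) := Metric.closedBall x₀ (Real.sqrt (B / η)) ∩ u ⁻¹' Ici σ with hKdef
  have hKc : IsCompact K :=
    (isCompact_closedBall _ _).inter_right (huusc.isClosed_preimage σ)
  have hupos : ∀ x, 0 < u x → 0 < w x := fun x hx => by
    refine (hw0 x).lt_of_ne fun h => ?_
    simp [hu, ← h, saturate] at hx
  have hKS : K ⊆ Sᶜ := fun x hx => (hwpos x (hupos x (hσpos.trans_le hx.2))).1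
  obtain ⟨ρ, hρ, hρS⟩ := hKc.exists_thickening_subset_open hS.isOpen_compl hKS
  set ρ' : ℝ := min ρ (δ / (4 * L)) with hρ'
  have hρ'pos : 0 < ρ' := by positivity
  set A : ℝ := 4 * B / ρ' ^ 2 with hA
  have hApos : 0 < A := by positivity
  obtain ⟨x, y, hmax⟩ := exists_isMax_doubling huusc hvlsc huB hv0 x₀ hσpos.le hApos hηpos
  have hval : σ ≤ u x - v y - A * ‖x - y‖ ^ 2 - η * ‖x - x₀‖ ^ 2 := by
    simpa [hσ] using hmax x₀ x₀
  have hAxy : 0 ≤ A * ‖x - y‖ ^ 2 := by positivity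
  have hηx : 0 ≤ η * ‖x - x₀‖ ^ 2 := by positivity
  have hux : σ ≤ u x := by linarith [hv0 y]
  have hxK : x ∈ K := by
    refine ⟨?_, hux⟩
    rw [Metric.mem_closedBall, dist_eq_norm]
    refine Real.le_sqrt_of_sq_le ((le_div_iff₀ hηpos).2 ?_)
    linarith [huB x, hv0 y]
  have hxy : ‖x - y‖ < ρ' := by
    refine lt_of_pow_lt_pow_left₀ 2 hρ'pos.le ?_
    have h1 : A * ‖x - y‖ ^ 2 ≤ B := by linarith [huB x, hv0 y]
    have h2 : A * ρ' ^ 2 = 4 * B := by rw [hA]; field_simp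
    nlinarith
  have hyS : y ∈ Sᶜ := by
    refine hρS (Metric.mem_thickening_iff.2 ⟨x, hxK, ?_⟩)
    rw [dist_comm, dist_eq_norm]
    exact hxy.trans_le (min_le_left _ _)
  obtain ⟨hxS, hm₁x⟩ := hwpos x (hupos x (hσpos.trans_le hux))
  set P : 𝔼 d := (2 * A) • (x - y) with hP
  set E : 𝔼 d := (2 * η) • (x - x₀) with hE
  have hEe : ‖E‖ < e := by
    refine lt_of_pow_lt_pow_left₀ 2 hepos.le ?_
    have h1 : η * ‖x - x₀‖ ^ 2 ≤ B := by linarith [huB x, hv0 y]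
    have h2 : η * (8 * B) = e ^ 2 := by rw [hη]; field_simp
    rw [hE, norm_smul, Real.norm_of_nonneg (by positivity)]
    nlinarith
  have hsuper : μ ≤ H P y := by
    have hg : HasGradientAt (fun z => -A * ‖z - x‖ ^ 2) P y := by
      have h := hasGradientAt_const_mul_norm_sub_sq (-A) y x
      have h' : (2 * -A) • (y - x) = P := by rw [hP]; module
      rwa [h'] at h
    have h := h₂.viscosity (fun z => -A * ‖z - x‖ ^ 2) y hyS
      (contDiffAt_const.mul ((contDiffAt_id.sub contDiffAt_const).norm_sq ℝ)) ?_
    · rwa [hg.gradient] at h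
    · filter_upwards [hS.isOpen_compl.mem_nhds hyS] with z hz
      have h3 := hmax x z
      simp only [hv, if_neg hz, if_neg hyS] at h3
      rw [norm_sub_rev y x, norm_sub_rev z x]
      linarith
  have hsub : ∃ θ ξ, 0 ≤ θ ∧ θ ≤ l ∧ P + E = θ • ξ ∧ H ξ x ≤ μ := by
    refine h₁.viscosity.exists_smul_of_saturate hl hk hxS hw0 ?_ hm₁x
      (ψ := fun z => A * ‖z - y‖ ^ 2 + η * ‖z - x₀‖ ^ 2 +
        (u x - A * ‖x - y‖ ^ 2 - η * ‖x - x₀‖ ^ 2)) ?_ ?_ ?_ ?_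
    · filter_upwards [hS.isOpen_compl.mem_nhds hxS] with z hz
      simp only [hw, if_neg hz]
      exact le_max_left _ _
    · exact ((contDiffAt_const.mul ((contDiffAt_id.sub contDiffAt_const).norm_sq ℝ)).add
        (contDiffAt_const.mul ((contDiffAt_id.sub contDiffAt_const).norm_sq ℝ))).add
        contDiffAt_const
    · have h1 := hasGradientAt_const_mul_norm_sub_sq A x y
      have h2 := hasGradientAt_const_mul_norm_sub_sq η x x₀
      rw [hasGradientAt_iff_hasFDerivAt] at h1 h2 ⊢
      rw [map_add]
      exact (h1.add h2).add_const _
    · intro z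
      linarith [hmax z y]
    · simp only [hu]
      ring
  obtain ⟨θ, ξ, hθ0, hθl, hPE, hξ⟩ := hsub
  have hstrict : H (P + E) x ≤ μ - δ := hPE ▸ hmargin ξ x hξ θ hθ0 hθl
  have hPEn : ‖P + E‖ ≤ R + 1 := (hR _ x (by linarith)).trans (by linarith)
  have hPn : ‖P‖ ≤ R + 1 := by
    have h1 : ‖P‖ ≤ ‖P + E‖ + ‖E‖ := by
      simpa using norm_sub_le (P + E) E
    have h2 := hR (P + E) x (by linarith)
    have h3 : e ≤ 1 := (min_le_left _ _).trans (min_le_left _ _)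
    linarith
  have hPr : r < ‖P‖ := by
    by_contra! h
    linarith [hr' P y h]
  have hP0 : P ≠ 0 := norm_pos_iff.1 (hr.trans hPr)
  have h1 := hH.sub_le_of_space (by linarith) hP0 hPn x y
  have h2 := hH.sub_le_of_segment (by linarith) hPn hPEn (fun t ht h0 => by
    have h3 : P = -(t • E) := eq_neg_of_add_eq_zero_left h0
    have h4 : ‖P‖ ≤ ‖E‖ := by
      rw [h3, norm_neg, norm_smul, Real.norm_of_nonneg ht.1.le]
      exact mul_le_of_le_one_left (norm_nonneg _) ht.2.le
    have h5 : e ≤ r := (min_le_left _ _).trans (min_le_right _ _)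
    linarith) x
  rw [← hL] at h1 h2
  have hLδ : L * (δ / (4 * L)) = δ / 4 := by field_simp
  have h3 : L * ‖y - x‖ ≤ δ / 4 := by
    rw [← hLδ, norm_sub_rev]
    exact mul_le_mul_of_nonneg_left (hxy.le.trans (min_le_right _ _)) hLpos.le
  have h4 : L * ‖E‖ ≤ δ / 4 := by
    rw [← hLδ]
    exact mul_le_mul_of_nonneg_left (hEe.le.trans (min_le_right _ _)) hLpos.le
  linarith [le_abs_self (H P y - H P x), neg_abs_le (H (P + E) x - H P x)]
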